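/- Let $G_1,G_2$ be compact (Hausdorff) topological groups. For a compact group $G$ with normalized Haar measure $dg$, let $C(G)$ be the space of continuous functions $G\to\mathbb C$ with the supremum norm, and let $\mathcal P(G)\subset C(G)$ be the set of positive definite functions, that is, of those $\varphi\in C(G)$ with $$\iint \overline{f(g)}\,\varphi(g^{-1}h)\,f(h)\,dg\,dh\;\ge 0\qquad\text{for all } f\in C(G).$$ Let $\mathcal P_1(G)=\{\varphi\in\mathcal P(G):\varphi(e)=1\}$, and let $\mathcal E_1(G)$ be the set of pure functions in $\mathcal P_1(G)$, that is, of those whose GNS representation is irreducible: $\varphi(g)=\langle v,\pi(g)v\rangle$ for an irreducible strongly continuous unitary representation $\pi$ of $G$ on a Hilbert space with a cyclic vector $v$. A function $\varphi\in\mathcal P_1(G_1\times G_2)$ is called separable if it is a uniform limit of functions in $\mathcal P_1(G_1\times G_2)$ that are finite convex combinations $$(g_1,g_2)\mapsto\sum_{m=1}^K p_m\,\varepsilon_m(g_1)\,\eta_m(g_2),\qquad p_m\ge 0,\ \sum_{m=1}^K p_m=1,\ \varepsilon_m\in\mathcal E_1(G_1),\ \eta_m\in\mathcal E_1(G_2).$$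 For a bounded linear map $\Lambda\colon C(G_2)\to C(G_1)$, let $\mathrm{id}\otimes\Lambda\colon C(G_1\times G_2)\to C(G_1\times G_1)$ be the unique bounded linear map with $(\mathrm{id}\otimes\Lambda)(f\otimes\xi)=f\otimes\Lambda\xi$ for all $f\in C(G_1)$, $\xi\in C(G_2)$, where $(f\otimes\xi)(x,y)=f(x)\,\xi(y)$. **Theorem.** A function $\varphi\in\mathcal P_1(G_1\times G_2)$ is separable if and only if for every bounded linear map $\Lambda\colon C(G_2)\to C(G_1)$ with $\Lambda\,\mathcal P(G_2)\subset\mathcal P(G_1)$ the function $(\mathrm{id}\otimes\Lambda)\varphi$ is positive definite on $G_1\times G_1$. -/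

import Mathlib

open scoped ComplexOrder ComplexConjugate

universe u v w

noncomputable section

namespace CompactGroup

/-- The Haar measure of total mass one on the Borel sets of a compact group.  The Borel
`σ`-algebra is passed explicitly, so that the definition also makes sense on a product of two
groups that are not second countable. -/
def haar (G : Type u) [Group G] [TopologicalSpace G] [IsTopologicalGroup G] [CompactSpace G] :
    @MeasureTheory.Measure G (borel G) :=
  letI : MeasurableSpace G := borel G
  haveI : BorelSpace G := ⟨rfl⟩
  MeasureTheory.Measure.haarMeasure ⊤

/-- A continuous function `φ` on a compact group is positive definite if
`∬ conj (f g) φ(g⁻¹ h) f(h) dg dh` is a nonnegative real number for every continuous `f`.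
(On a compact group, continuous functions are bounded and have compact support.
The order on `ℂ` is the one for which `0 ≤ z` says that `z` is real and nonnegative.) -/
def IsPositiveDefinite {G : Type u} [Group G] [TopologicalSpace G] [IsTopologicalGroup G]
    [CompactSpace G] (φ : C(G, ℂ)) : Prop :=
  ∀ f : C(G, ℂ),
    0 ≤ ∫ g, (∫ h, conj (f g) * φ (g⁻¹ * h) * f h ∂(haar G)) ∂(haar G)

/-- The set `𝒫(G)` of continuous positive definite functions on `G`. -/
def PD (G : Type u) [Group G] [TopologicalSpace G] [IsTopologicalGroup G] [CompactSpace G] :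
    Set C(G, ℂ) :=
  {φ | IsPositiveDefinite φ}

/-- The set `𝒫₁(G)` of continuous positive definite functions `φ` on `G` with `φ(e) = 1`. -/
def PDOne (G : Type u) [Group G] [TopologicalSpace G] [IsTopologicalGroup G] [CompactSpace G] :
    Set C(G, ℂ) :=
  {φ | φ ∈ PD G ∧ φ 1 = 1}

/-- A (strongly continuous) unitary representation of `G` in an inner product space `H`. -/
structure UnitaryRep (G : Type u) [Group G] [TopologicalSpace G]
    (H : Type v) [NormedAddCommGroup H] [InnerProductSpace ℂ H] where
  /-- The underlying homomorphism to the group of unitary operators. -/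
  toHom : G →* (H ≃ₗᵢ[ℂ] H)
  continuous_apply : ∀ x : H, Continuous fun g => toHom g x

namespace UnitaryRep

variable {G : Type u} [Group G] [TopologicalSpace G]
  {H : Type v} [NormedAddCommGroup H] [InnerProductSpace ℂ H]

/-- The vector `x` is cyclic: its orbit spans a dense subspace. -/
def IsCyclicVector (π : UnitaryRep G H) (x : H) : Prop :=
  Dense (Submodule.span ℂ (Set.range fun g => π.toHom g x) : Set H)

/-- Topological irreducibility: the space is nonzero, and its only closed invariant subspaces
are `0` and the whole space. -/
def IsIrreducible (π : UnitaryRep G H) : Prop :=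
  Nontrivial H ∧ ∀ K : Submodule ℂ H, IsClosed (K : Set H) →
    (∀ g : G, ∀ x ∈ K, π.toHom g x ∈ K) → K = ⊥ ∨ K = ⊤

end UnitaryRep

/-- The function `φ` is pure: its GNS representation is irreducible.  That is, there is an
irreducible unitary representation `π` of `G` in a Hilbert space with a cyclic vector `x` such
that `φ(g) = ⟪x, π(g) x⟫`.  (The triple `(H, π, x)` is determined by `φ` up to unitary
equivalence, and the inner product is linear in its second argument.) -/
def IsPure {G : Type u} [Group G] [TopologicalSpace G] (φ : C(G, ℂ)) : Prop :=
  ∃ (H : Type u) (_ : NormedAddCommGroup H) (_ : InnerProductSpace ℂ H) (_ : CompleteSpace H)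
    (π : UnitaryRep G H) (x : H),
    π.IsCyclicVector x ∧ (∀ g, φ g = inner ℂ x (π.toHom g x)) ∧ π.IsIrreducible

/-- The set `ℰ₁(G)` of pure normalized continuous positive definite functions on `G`. -/
def PureOne (G : Type u) [Group G] [TopologicalSpace G] [IsTopologicalGroup G]
    [CompactSpace G] : Set C(G, ℂ) :=
  {φ | φ ∈ PDOne G ∧ IsPure φ}

section Separability

variable (G₁ : Type u) [Group G₁] [TopologicalSpace G₁] [IsTopologicalGroup G₁] [CompactSpace G₁]
  (G₂ : Type v) [Group G₂] [TopologicalSpace G₂] [IsTopologicalGroup G₂] [CompactSpace G₂]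

/-- The functions in `𝒫₁(G₁ × G₂)` that are finite convex combinations of products
`(g₁, g₂) ↦ ε(g₁) η(g₂)` with `ε ∈ ℰ₁(G₁)` and `η ∈ ℰ₁(G₂)`. -/
def SepZero : Set C(G₁ × G₂, ℂ) :=
  {φ | φ ∈ PDOne (G₁ × G₂) ∧
    ∃ (K : ℕ) (p : Fin K → ℝ) (ε : Fin K → C(G₁, ℂ)) (η : Fin K → C(G₂, ℂ)),
      (∀ m, 0 ≤ p m) ∧ ∑ m, p m = 1 ∧ (∀ m, ε m ∈ PureOne G₁) ∧ (∀ m, η m ∈ PureOne G₂) ∧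
      ∀ g₁ g₂, φ (g₁, g₂) = ∑ m, (p m : ℂ) * (ε m g₁ * η m g₂)}

/-- The separable functions: those in `𝒫₁(G₁ × G₂)` that are uniform limits of functions in
`SepZero G₁ G₂` (the norm of `C(G₁ × G₂, ℂ)` is the supremum norm). -/
def Sep : Set C(G₁ × G₂, ℂ) :=
  {φ | φ ∈ PDOne (G₁ × G₂) ∧ φ ∈ closure (SepZero G₁ G₂)}

end Separability

/-- A bounded linear map `Λ : C(G₂) → C(G₁)` preserves positive definiteness if
`Λ 𝒫(G₂) ⊆ 𝒫(G₁)`. -/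
def PreservesPD {G₁ : Type u} [Group G₁] [TopologicalSpace G₁] [IsTopologicalGroup G₁]
    [CompactSpace G₁] {G₂ : Type v} [Group G₂] [TopologicalSpace G₂] [IsTopologicalGroup G₂]
    [CompactSpace G₂] (Λ : C(G₂, ℂ) →L[ℂ] C(G₁, ℂ)) : Prop :=
  ∀ ψ ∈ PD G₂, Λ ψ ∈ PD G₁

section Tensor

variable {X : Type u} [TopologicalSpace X] [CompactSpace X]
  {Y : Type v} [TopologicalSpace Y] [CompactSpace Y]
  {Z : Type w} [TopologicalSpace Z] [CompactSpace Z] [LocallyCompactSpace Z]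

/-- The product function `f ⊗ ξ : (x, y) ↦ f(x) ξ(y)`. -/
def tmul (f : C(X, ℂ)) (ξ : C(Y, ℂ)) : C(X × Y, ℂ) where
  toFun q := f q.1 * ξ q.2

/-- The bounded operator `id ⊗ Λ : C(X × Y) → C(X × Z)` for a bounded linear map
`Λ : C(Y) → C(Z)`: it applies `Λ` in the second variable.  By `idTensor_tmul` and
`eq_idTensor` it is the only bounded operator with `(id ⊗ Λ)(f ⊗ ξ) = f ⊗ Λ ξ`. -/
def idTensor (Λ : C(Y, ℂ) →L[ℂ] C(Z, ℂ)) : C(X × Y, ℂ) →L[ℂ] C(X × Z, ℂ) :=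
  LinearMap.mkContinuous
    { toFun := fun F => ((⟨Λ, Λ.continuous⟩ : C(C(Y, ℂ), C(Z, ℂ))).comp F.curry).uncurry
      map_add' := fun F F' => by
        ext q
        have h : (F + F').curry q.1 = F.curry q.1 + F'.curry q.1 := rfl
        change Λ ((F + F').curry q.1) q.2 = Λ (F.curry q.1) q.2 + Λ (F'.curry q.1) q.2
        rw [h, map_add, ContinuousMap.add_apply]
      map_smul' := fun c F => by
        ext q
        have h : (c • F).curry q.1 = c • F.curry q.1 := rfl
        change Λ ((c • F).curry q.1) q.2 = c • Λ (F.curry q.1) q.2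
        rw [h, map_smul, ContinuousMap.smul_apply] }
    ‖Λ‖
    (fun F => by
      refine (ContinuousMap.norm_le _ (by positivity)).2 fun q => ?_
      change ‖Λ (F.curry q.1) q.2‖ ≤ _
      refine (ContinuousMap.norm_coe_le_norm _ _).trans ((Λ.le_opNorm _).trans ?_)
      gcongr
      exact (ContinuousMap.norm_le _ (norm_nonneg _)).2 fun y =>
        ContinuousMap.norm_coe_le_norm F (q.1, y))

theorem idTensor_apply (Λ : C(Y, ℂ) →L[ℂ] C(Z, ℂ)) (F : C(X × Y, ℂ)) (x : X) (z : Z) :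
    idTensor Λ F (x, z) = Λ (F.curry x) z := rfl

theorem idTensor_tmul (Λ : C(Y, ℂ) →L[ℂ] C(Z, ℂ)) (f : C(X, ℂ)) (ξ : C(Y, ℂ)) :
    idTensor Λ (tmul f ξ) = tmul f (Λ ξ) := by
  ext ⟨x, z⟩
  have h : (tmul f ξ).curry x = f x • ξ := rfl
  rw [idTensor_apply, h, map_smul]
  rfl

theorem exists_ne_of_ne [T2Space X] {s t : X} (hst : s ≠ t) : ∃ f : C(X, ℂ), f s ≠ f t := by
  obtain ⟨f, h0, h1, -⟩ := exists_continuous_zero_one_of_isClosed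
    (isClosed_singleton (x := s)) (isClosed_singleton (x := t)) (by simpa using hst)
  refine ⟨⟨fun z => (f z : ℂ), by fun_prop⟩, ?_⟩
  have e0 : f s = 0 := h0 rfl
  have e1 : f t = 1 := h1 rfl
  simp [e0, e1]

/-- Linear combinations of product functions are uniformly dense. -/
theorem dense_span_tmul [T2Space X] [T2Space Y] :
    Dense (Submodule.span ℂ {F : C(X × Y, ℂ) | ∃ f ξ, F = tmul f ξ} : Set C(X × Y, ℂ)) := by
  let S : Set C(X × Y, ℂ) := {F | ∃ f ξ, F = tmul f ξ}
  let M : Submonoid C(X × Y, ℂ) :=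
    { carrier := S
      mul_mem' := by
        rintro _ _ ⟨f, ξ, rfl⟩ ⟨f', ξ', rfl⟩
        refine ⟨f * f', ξ * ξ', ?_⟩
        ext q
        simp only [tmul, ContinuousMap.mul_apply, ContinuousMap.coe_mk]
        ring
      one_mem' := ⟨1, 1, by ext q; simp [tmul]⟩ }
  let A : StarSubalgebra ℂ C(X × Y, ℂ) :=
    { Algebra.adjoin ℂ (M : Set C(X × Y, ℂ)) with
      star_mem' := by
        intro a ha
        induction ha using Algebra.adjoin_induction with
        | mem x hx =>
          obtain ⟨f, ξ, rfl⟩ := hx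
          refine Algebra.subset_adjoin ⟨star f, star ξ, ?_⟩
          ext q
          simp [tmul]
        | algebraMap r =>
          rw [← algebraMap_star_comm]
          exact Subalgebra.algebraMap_mem _ _
        | add x y _ _ hx hy =>
          rw [star_add]
          exact Subalgebra.add_mem _ hx hy
        | mul x y _ _ hx hy =>
          rw [star_mul]
          exact Subalgebra.mul_mem _ hy hx }
  have hsep : A.SeparatesPoints := by
    rintro ⟨x, y⟩ ⟨x', y'⟩ hne
    by_cases hx : x = x'
    · obtain ⟨f, hf⟩ := exists_ne_of_ne (fun h => hne (by rw [hx, h]) : y ≠ y')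
      exact ⟨_, ⟨tmul 1 f, Algebra.subset_adjoin ⟨1, f, rfl⟩, rfl⟩, by simpa [tmul] using hf⟩
    · obtain ⟨f, hf⟩ := exists_ne_of_ne hx
      exact ⟨_, ⟨tmul f 1, Algebra.subset_adjoin ⟨f, 1, rfl⟩, rfl⟩, by simpa [tmul] using hf⟩
  have htop := ContinuousMap.starSubalgebra_topologicalClosure_eq_top_of_separatesPoints A hsep
  have hA : (A : Set C(X × Y, ℂ)) = (Submodule.span ℂ S : Set C(X × Y, ℂ)) := by
    have h := Algebra.adjoin_eq_span (R := ℂ) (M : Set C(X × Y, ℂ))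
    rw [Submonoid.closure_eq] at h
    exact congrArg (fun K : Submodule ℂ C(X × Y, ℂ) => (K : Set C(X × Y, ℂ))) h
  change Dense (Submodule.span ℂ S : Set C(X × Y, ℂ))
  rw [← hA, dense_iff_closure_eq, ← StarSubalgebra.topologicalClosure_coe, htop]
  rfl

/-- `id ⊗ Λ` is the only bounded operator that has the expected values on product functions. -/
theorem eq_idTensor [T2Space X] [T2Space Y] (Λ : C(Y, ℂ) →L[ℂ] C(Z, ℂ))
    (T : C(X × Y, ℂ) →L[ℂ] C(X × Z, ℂ)) (hT : ∀ f ξ, T (tmul f ξ) = tmul f (Λ ξ)) :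
    T = idTensor Λ := by
  refine ContinuousLinearMap.ext_on dense_span_tmul ?_
  rintro _ ⟨f, ξ, rfl⟩
  rw [hT, idTensor_tmul]

end Tensor

end CompactGroup

end

/-!
Positive definiteness of a continuous function `φ` is equivalent to positive semidefiniteness of
the kernel `(x, y) ↦ φ(x⁻¹ y)` (`isPositiveDefinite_iff_posSemidef`): one direction tests the
integral against sums of approximate point masses, the other realizes `φ` as a diagonal coefficient
`⟪x, π(g) x⟫` on the reproducing kernel Hilbert space of the kernel, where the double integral is
`‖∫ f(g) π(g) x dg‖²`. In the kernel form, closedness, restriction to the diagonal, and the Schur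
product are immediate. Hence `(id ⊗ Λ)(ε ⊗ η) = ε ⊗ Λη` is positive definite whenever `Λ` preserves
positive definiteness, and by linearity and continuity so is `(id ⊗ Λ) φ` for separable `φ`
(`idTensor_mem_PD_of_mem_sep`).

For the converse, the Hahn–Banach theorem separates a nonseparable `φ` from the convex hull of the
products of pure functions. After shifting by a multiple of the evaluation at `1` and passing to the
Hermitian part, this is a functional `ℓ` that is nonnegative on products of pure functions but not
at `φ` (`exists_functional_of_notMem_sep`). It is nonnegative on all products of positive definite
functions because these lie in the closed cone generated by the pure ones
(`IsPositiveDefinite.mem_closure_span_pureOne`). This is a form of the Peter–Weyl theorem: the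
average over `G` of the orbit of the rank one operator `|v⟩⟨v|` is a compact selfadjoint operator
commuting with the representation, and `v` is orthogonal to its kernel, so `v` is a limit
of vectors in finite-dimensional invariant subspaces. On these, coefficients split into pure ones.

The functional `ℓ` has to be turned into an operator `Λ : C(G₂) → C(G₁)`. Slicing it yields only a
measure on `G₁` for each `ξ ∈ C(G₂)`, so the slices are smeared: with a density `u` supported near
`1`, put `(Λ ξ)(g) = ℓ(a_g ⊗ ξ)`, where `a_g(x) = ∫ u(s) u(g⁻¹ s x) ds` approximates the point mass
at `g`. For coefficients `c_i` and points `g_i` of `G₁`, the sum of all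
`conj c_i c_j a_{g_i⁻¹ g_j}` is the autocorrelation of `∑ c_i u(g_i⁻¹ ·)`, which is positive
definite, so `Λ` preserves positive definiteness (`preservesPD_smearedSlice`). If `(id ⊗ Λ) φ` is
positive definite, so is its restriction to the diagonal, whose integral is therefore nonnegative.
This integral is the value of `ℓ` at a mollification of `φ`, which tends to `φ` uniformly as `u`
concentrates at `1`; therefore `ℓ(φ) ≥ 0` (`nonneg_of_forall_smearedSlice`).
-/

noncomputable section

open MeasureTheory

namespace CompactGroup

/-! ### Haar integration of continuous functions -/

section Haar

variable {G : Type u} [Group G] [TopologicalSpace G] [IsTopologicalGroup G] [CompactSpace G]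
  {E : Type w} [NormedAddCommGroup E]

instance isProbabilityMeasure_haar : IsProbabilityMeasure (haar G) := by
  let _ : MeasurableSpace G := borel G
  have : BorelSpace G := ⟨rfl⟩
  refine ⟨?_⟩
  have h := Measure.haarMeasure_self (K₀ := (⊤ : TopologicalSpace.PositiveCompacts G))
  simpa [haar] using h

theorem integrable_haar {f : G → E} (hf : Continuous f) : Integrable f (haar G) := by
  let _ : MeasurableSpace G := borel G
  have : BorelSpace G := ⟨rfl⟩
  have : IsFiniteMeasureOnCompacts (haar G) := ⟨fun K _ => measure_lt_top _ K⟩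
  exact hf.integrable_of_hasCompactSupport (HasCompactSupport.of_compactSpace f)

variable [NormedSpace ℝ E]

theorem integral_haar_mul_left (f : G → E) (a : G) :
    ∫ g, f (a * g) ∂(haar G) = ∫ g, f g ∂(haar G) := by
  let _ : MeasurableSpace G := borel G
  have : BorelSpace G := ⟨rfl⟩
  have : (haar G).IsMulLeftInvariant := by unfold haar; infer_instance
  exact integral_mul_left_eq_self f a

theorem integral_haar_swap {G' : Type v} [Group G'] [TopologicalSpace G'] [IsTopologicalGroup G']
    [CompactSpace G'] {F : G → G' → E} (hF : Continuous fun q : G × G' => F q.1 q.2) :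
    ∫ g, (∫ h, F g h ∂(haar G')) ∂(haar G) = ∫ h, (∫ g, F g h ∂(haar G)) ∂(haar G') := by
  let _ : MeasurableSpace G := borel G
  have : BorelSpace G := ⟨rfl⟩
  let _ : MeasurableSpace G' := borel G'
  have : BorelSpace G' := ⟨rfl⟩
  have : IsFiniteMeasureOnCompacts (haar G) := ⟨fun K _ => measure_lt_top _ K⟩
  have : IsFiniteMeasureOnCompacts (haar G') := ⟨fun K _ => measure_lt_top _ K⟩
  exact integral_integral_swap_of_hasCompactSupport hF (HasCompactSupport.of_compactSpace _)

/-- Compact groups are unimodular: both sides are the value of the double integral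
`∬ f (g⁻¹ h) dg dh`. -/
theorem integral_haar_inv [CompleteSpace E] {f : G → E} (hf : Continuous f) :
    ∫ g, f g⁻¹ ∂(haar G) = ∫ g, f g ∂(haar G) := by
  have h := integral_haar_swap (F := fun g h : G => f (g⁻¹ * h)) (by fun_prop)
  have h1 (g : G) : ∫ h, f (g⁻¹ * h) ∂(haar G) = ∫ h, f h ∂(haar G) := integral_haar_mul_left f g⁻¹
  have h2 (h : G) : ∫ g, f (g⁻¹ * h) ∂(haar G) = ∫ g, f g⁻¹ ∂(haar G) := by
    rw [← integral_haar_mul_left (fun g => f (g⁻¹ * h)) h]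
    simp
  simpa [h1, h2] using h.symm

theorem integral_haar_mul_right [CompleteSpace E] {f : G → E} (hf : Continuous f) (a : G) :
    ∫ g, f (g * a) ∂(haar G) = ∫ g, f g ∂(haar G) := by
  rw [← integral_haar_inv (f := fun g => f (g * a)) (by fun_prop), ← integral_haar_inv hf,
    ← integral_haar_mul_left (fun g => f g⁻¹) a⁻¹]
  simp

theorem continuous_integral_haar {X : Type*} [TopologicalSpace X] {F : X → G → E}
    (hF : Continuous fun q : X × G => F q.1 q.2) :
    Continuous fun x => ∫ g, F x g ∂(haar G) := by
  let _ : MeasurableSpace G := borel G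
  have : BorelSpace G := ⟨rfl⟩
  have : IsFiniteMeasureOnCompacts (haar G) := ⟨fun K _ => measure_lt_top _ K⟩
  rw [← continuousOn_univ]
  exact continuousOn_integral_of_compact_support isCompact_univ hF.continuousOn (by simp)

theorem eq_zero_of_integral_haar_eq_zero {f : G → ℝ} (hf : Continuous f) (h0 : ∀ g, 0 ≤ f g)
    (h : ∫ g, f g ∂(haar G) = 0) (g : G) : f g = 0 := by
  let _ : MeasurableSpace G := borel G
  have : BorelSpace G := ⟨rfl⟩
  have : (haar G).IsHaarMeasure := by unfold haar; infer_instance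
  have h1 := (integral_eq_zero_iff_of_nonneg h0 (integrable_haar hf)).1 h
  exact congrFun (Continuous.ae_eq_iff_eq (haar G) hf continuous_const |>.1 h1) g

theorem integral_haar_clm_comp {𝕜 F : Type*} [RCLike 𝕜] [NormedSpace 𝕜 E] [CompleteSpace E]
    [NormedAddCommGroup F] [NormedSpace 𝕜 F] [NormedSpace ℝ F] [CompleteSpace F] (L : E →L[𝕜] F)
    {f : G → E} (hf : Continuous f) : ∫ g, L (f g) ∂(haar G) = L (∫ g, f g ∂(haar G)) := by
  let _ : MeasurableSpace G := borel G
  exact L.integral_comp_comm (integrable_haar hf)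

theorem integral_haar_apply {X : Type*} [TopologicalSpace X] [CompactSpace X] [CompleteSpace E]
    {f : G → C(X, E)} (hf : Continuous f) (x : X) :
    (∫ g, f g ∂(haar G)) x = ∫ g, f g x ∂(haar G) := by
  let _ : MeasurableSpace G := borel G
  exact ContinuousMap.integral_apply (integrable_haar hf) x

/-- Approximate identities: every neighbourhood of `1` supports a probability density. -/
theorem exists_density_of_mem_nhds_one [T2Space G] {V : Set G} (hV : V ∈ nhds 1) :
    ∃ u : C(G, ℝ), (∀ g, 0 ≤ u g) ∧ ∫ g, u g ∂(haar G) = 1 ∧ ∀ g ∉ V, u g = 0 := by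
  obtain ⟨w, hw0, hw1, hw⟩ := exists_continuous_zero_one_of_isClosed
    (isOpen_interior (s := V)).isClosed_compl (isClosed_singleton (x := (1 : G)))
    (by simpa [mem_interior_iff_mem_nhds] using hV)
  have h1 : w 1 = 1 := hw1 rfl
  have hI : ∫ g, w g ∂(haar G) ≠ 0 := fun h => by
    simpa [h1] using eq_zero_of_integral_haar_eq_zero w.continuous (fun g => (hw g).1) h 1
  have hI0 : 0 ≤ ∫ g, w g ∂(haar G) := integral_nonneg fun g => (hw g).1
  refine ⟨(∫ g, w g ∂(haar G))⁻¹ • w, fun g => ?_, ?_, fun g hg => ?_⟩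
  · exact mul_nonneg (inv_nonneg.2 hI0) (hw g).1
  · simp [integral_const_mul, hI]
  · have : w g = 0 := hw0 fun h => hg (interior_subset h)
    simp [this]

/-- Averaging against a density changes a vector `y` by at most the oscillation on its support. -/
theorem norm_integral_density_smul_sub_le [CompleteSpace E] {u : C(G, ℝ)} (hu : ∀ g, 0 ≤ u g)
    (hu1 : ∫ g, u g ∂(haar G) = 1) {V : Set G} (huV : ∀ g ∉ V, u g = 0) {f : G → E}
    (hf : Continuous f) {y : E} {ε : ℝ} (h : ∀ g ∈ V, ‖f g - y‖ ≤ ε) :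
    ‖∫ g, u g • f g ∂(haar G) - y‖ ≤ ε := by
  let _ : MeasurableSpace G := borel G
  have hy : y = ∫ g, u g • y ∂(haar G) := by rw [integral_smul_const, hu1, one_smul]
  have hε : ε = ∫ g, u g * ε ∂(haar G) := by rw [integral_mul_const, hu1, one_mul]
  conv_lhs => rw [hy]
  rw [← integral_sub (integrable_haar (by fun_prop)) (integrable_haar (by fun_prop)), hε]
  refine norm_integral_le_of_norm_le (integrable_haar (by fun_prop))
    (Filter.Eventually.of_forall fun g => ?_)
  rw [← smul_sub, norm_smul, Real.norm_of_nonneg (hu g)]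
  by_cases hg : g ∈ V
  · exact mul_le_mul_of_nonneg_left (h g hg) (hu g)
  · simp [huV g hg]

theorem norm_integral_density_smul_smul_sub_le [CompleteSpace E] {u : C(G, ℝ)} (hu : ∀ g, 0 ≤ u g)
    (hu1 : ∫ g, u g ∂(haar G) = 1) {V : Set G} (huV : ∀ g ∉ V, u g = 0) {f : G → G → E}
    (hf : Continuous fun q : G × G => f q.1 q.2) {y : E} {ε : ℝ}
    (h : ∀ g ∈ V, ∀ h ∈ V, ‖f g h - y‖ ≤ ε) :
    ‖∫ g, u g • (∫ h, u h • f g h ∂(haar G)) ∂(haar G) - y‖ ≤ ε :=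
  norm_integral_density_smul_sub_le hu hu1 huV
    (continuous_integral_haar (F := fun g h => u h • f g h) (by fun_prop)) fun g hg =>
      norm_integral_density_smul_sub_le hu hu1 huV (hf.comp (by fun_prop : Continuous (Prod.mk g)))
        (h g hg)

end Haar

/-! ### Unitary representations and the GNS construction -/

namespace UnitaryRep

variable {G : Type u} [Group G] [TopologicalSpace G]
  {H : Type v} [NormedAddCommGroup H] [InnerProductSpace ℂ H]

/-- A multiplicative family of linear isometries, pointwise continuous in the group variable, is a
unitary representation. -/
def ofIsometries (U : G → H →ₗ[ℂ] H) (one : U 1 = LinearMap.id)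
    (mul : ∀ g h, U (g * h) = U g ∘ₗ U h) (norm : ∀ g x, ‖U g x‖ = ‖x‖)
    (cont : ∀ x, Continuous fun g => U g x) : UnitaryRep G H where
  toHom :=
    { toFun g :=
        { toLinearEquiv := LinearEquiv.ofLinearMap (U g) (U g⁻¹)
            (by rw [← mul, mul_inv_cancel, one]) (by rw [← mul, inv_mul_cancel, one])
          norm_map' := norm g }
      map_one' := by
        ext x
        exact congrArg (· x) one
      map_mul' g h := by
        ext x
        exact congrArg (· x) (mul g h) }
  continuous_apply := cont

theorem toHom_inv_apply_apply (π : UnitaryRep G H) (g : G) (x : H) :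
    π.toHom g⁻¹ (π.toHom g x) = x := by
  have h : π.toHom (g⁻¹ * g) x = x := by simp
  rwa [map_mul] at h

theorem inner_toHom_right (π : UnitaryRep G H) (g : G) (x y : H) :
    inner ℂ x (π.toHom g y) = inner ℂ (π.toHom g⁻¹ x) y := by
  rw [← (π.toHom g⁻¹).inner_map_map x, toHom_inv_apply_apply]

theorem inner_toHom_inv_mul (π : UnitaryRep G H) (g h : G) (x y : H) :
    inner ℂ x (π.toHom (g⁻¹ * h) y) = inner ℂ (π.toHom g x) (π.toHom h y) := by
  rw [map_mul]
  change inner ℂ x (π.toHom g⁻¹ (π.toHom h y)) = _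
  rw [inner_toHom_right, inv_inv]

/-- The matrix coefficient `g ↦ ⟪x, π(g) x⟫`. -/
def coeff (π : UnitaryRep G H) (x : H) : C(G, ℂ) where
  toFun g := inner ℂ x (π.toHom g x)
  continuous_toFun := continuous_const.inner (π.continuous_apply x)

@[simp]
theorem coeff_apply (π : UnitaryRep G H) (x : H) (g : G) :
    π.coeff x g = inner ℂ x (π.toHom g x) := rfl

/-- A map `k` from `G` to a Hilbert space with dense span whose Gram kernel is invariant under left
translations carries a unitary representation that translates `k`. -/
theorem exists_toHom_apply_eq_of_inner_invariant [IsTopologicalGroup G] [CompleteSpace H]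
    {k : G → H} (hk : Continuous k) (hd : Dense (Submodule.span ℂ (Set.range k) : Set H))
    (hinv : ∀ g x y, inner ℂ (k (g * x)) (k (g * y)) = inner ℂ (k x) (k y)) :
    ∃ π : UnitaryRep G H, ∀ g x, π.toHom g (k x) = k (g * x) := by
  let e (g : G) : (G →₀ ℂ) →ₗ[ℂ] H := Finsupp.linearCombination ℂ fun x => k (g * x)
  have he1 : e 1 = Finsupp.linearCombination ℂ k := by simp [e]
  have hdense : DenseRange (e 1) := by
    have : Set.range (e 1) = (Submodule.span ℂ (Set.range k) : Set H) := by
      rw [he1, ← Finsupp.range_linearCombination, LinearMap.coe_range]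
    rw [DenseRange, this]
    exact hd
  have hnorm (g : G) (c : G →₀ ℂ) : ‖e g c‖ = ‖e 1 c‖ := by
    have h : inner ℂ (e g c) (e g c) = inner ℂ (e 1 c) (e 1 c) := by
      simp only [e, Finsupp.linearCombination_apply, Finsupp.sum_inner, Finsupp.inner_sum, hinv,
        inner_smul_left, inner_smul_right]
    rw [@norm_eq_sqrt_re_inner ℂ, @norm_eq_sqrt_re_inner ℂ, h]
  let U (g : G) : H →L[ℂ] H := (e g).extendOfNorm (e 1)
  have hUe (g : G) (c : G →₀ ℂ) : U g (e 1 c) = e g c :=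
    LinearMap.extendOfNorm_eq hdense ⟨1, fun c => by rw [hnorm g, one_mul]⟩ c
  have hUk (g x : G) : U g (k x) = k (g * x) := by
    have := hUe g (Finsupp.single x 1)
    simpa [e] using this
  have hUnorm (g : G) (x : H) : ‖U g x‖ = ‖x‖ := by
    induction x using hdense.induction_on with
    | hp => exact isClosed_eq (by fun_prop) (by fun_prop)
    | ih c => rw [hUe, hnorm]
  have hext {S T : H →L[ℂ] H} (h : ∀ x, S (k x) = T (k x)) : S = T :=
    ContinuousLinearMap.ext_on hd (by rintro _ ⟨x, rfl⟩; exact h x)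
  have hone : U 1 = ContinuousLinearMap.id ℂ H := hext fun x => by simp [hUk]
  have hmul (g h : G) : U (g * h) = U g ∘L U h := hext fun x => by simp [hUk, mul_assoc]
  have hcont (x : H) : Continuous fun g => U g x := by
    refine continuous_of_uniform_approx_of_continuous fun u hu => ?_
    obtain ⟨ε, hε, hεu⟩ := Metric.mem_uniformity_dist.1 hu
    obtain ⟨c, hc⟩ := hdense.exists_dist_lt x hε
    refine ⟨fun g => e g c, ?_, fun g => hεu ?_⟩
    · simp only [e, Finsupp.linearCombination_apply, Finsupp.sum]
      fun_prop
    · change dist (U g x) (e g c) < ε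
      rwa [← hUe, dist_eq_norm, ← map_sub, hUnorm, ← dist_eq_norm]
  exact ⟨ofIsometries (fun g => (U g).toLinearMap) (by rw [hone]; rfl)
    (fun g h => by rw [hmul]; rfl) hUnorm hcont, hUk⟩

end UnitaryRep

/-- The kernel `(x, y) ↦ φ(x⁻¹ y)` of a function on a group. -/
def invKernel {G : Type u} [Group G] (φ : G → ℂ) : Matrix G G ℂ := .of fun x y => φ (x⁻¹ * y)

theorem invKernel_apply {G : Type u} [Group G] (φ : G → ℂ) (x y : G) :
    invKernel φ x y = φ (x⁻¹ * y) := rfl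

/-- The reproducing kernel Hilbert space of a positive semidefinite complex matrix, reduced to its
kernel vectors. -/
theorem exists_inner_eq_of_posSemidef {X : Type u} {K : Matrix X X ℂ} (hK : K.PosSemidef) :
    ∃ (H : Type u) (_ : NormedAddCommGroup H) (_ : InnerProductSpace ℂ H) (_ : CompleteSpace H)
      (k : X → H), Dense (Submodule.span ℂ (Set.range k) : Set H) ∧
        ∀ x y, inner ℂ (k x) (k y) = K x y := by
  -- Hilbert spaces of functions with values in `ℂ` have operator-valued kernels
  let K' : Matrix X X (ℂ →L[ℂ] ℂ) := .of fun x y => K x y • 1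
  have hK' (x y : X) (w : ℂ) : K' x y w = K x y * w := rfl
  have hherm : K'.IsHermitian := by
    refine Matrix.IsHermitian.ext fun x y => ?_
    simp only [K', Matrix.of_apply, star_smul, star_one, hK.isHermitian.apply]
  have hpos : K'.PosSemidef := by
    have htfae : K'.PosSemidef ↔ K'.IsHermitian ∧ ∀ c : X →₀ ℂ, 0 ≤ RCLike.re
        (c.sum fun x w => c.sum fun y z => inner ℂ (K' y x w) z) :=
      RKHS.posSemidef_tfae.out 0 2
    refine htfae.2 ⟨hherm, fun c => ?_⟩
    have h := (Complex.le_def.1 (hK.2 c)).1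
    convert! h using 2
    refine Finsupp.sum_congr fun x _ => Finsupp.sum_congr fun y _ => ?_
    have := hK.isHermitian.apply x y
    simp only [hK', RCLike.inner_apply, map_mul, ← this]
    simp
    ring
  have : Fact K'.PosSemidef := ⟨hpos⟩
  refine ⟨RKHS.OfKernel K', inferInstance, inferInstance, inferInstance,
    fun x => RKHS.kerFun (RKHS.OfKernel K') x 1, ?_, fun x y => ?_⟩
  · have h := RKHS.kerFun_dense (RKHS.OfKernel K')
    rw [← Submodule.dense_iff_topologicalClosure_eq_top] at h
    refine h.mono (Submodule.span_le.2 ?_)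
    rintro _ ⟨x, w, rfl⟩
    have : RKHS.kerFun (RKHS.OfKernel K') x w = w • RKHS.kerFun (RKHS.OfKernel K') x 1 := by
      rw [← map_smul, smul_eq_mul, mul_one]
    rw [this]
    exact Submodule.smul_mem _ _ (Submodule.subset_span ⟨x, rfl⟩)
  · have h := RKHS.kernel_inner (RKHS.OfKernel K') y x (1 : ℂ) (1 : ℂ)
    rw [← h, RKHS.OfKernel.kernel_ofKernel]
    have := hK.isHermitian.apply x y
    simpa [hK'] using this

section

variable {G : Type u} [Group G] [TopologicalSpace G] [IsTopologicalGroup G]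

/-- The Gelfand–Naimark–Segal construction for continuous positive definite functions. -/
theorem exists_coeff_eq_of_posSemidef (φ : C(G, ℂ)) (hφ : (invKernel φ).PosSemidef) :
    ∃ (H : Type u) (_ : NormedAddCommGroup H) (_ : InnerProductSpace ℂ H) (_ : CompleteSpace H)
      (π : UnitaryRep G H) (x : H), φ = π.coeff x := by
  obtain ⟨H, _, _, _, k, hd, hk⟩ := exists_inner_eq_of_posSemidef hφ
  simp only [invKernel_apply] at hk
  have hc : Continuous k := by
    refine continuous_iff_continuousAt.2 fun x => ?_
    rw [ContinuousAt, tendsto_iff_norm_sub_tendsto_zero]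
    -- `‖k y - k x‖² = 2 φ(1) - φ(y⁻¹ x) - φ(x⁻¹ y)`
    have h1 (y : G) : ‖k y - k x‖ =
        √(φ 1 - φ (y⁻¹ * x) - (φ (x⁻¹ * y) - φ 1)).re := by
      rw [@norm_eq_sqrt_re_inner ℂ, inner_sub_left, inner_sub_right, inner_sub_right]
      simp only [hk, inv_mul_cancel]
      rfl
    simp only [h1]
    have h2 : Continuous fun y : G =>
        √(φ 1 - φ (y⁻¹ * x) - (φ (x⁻¹ * y) - φ 1)).re := by fun_prop
    simpa using h2.tendsto x
  obtain ⟨π, hπ⟩ := UnitaryRep.exists_toHom_apply_eq_of_inner_invariant hc hd fun g x y => by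
    rw [hk, hk]; congr 1; group
  refine ⟨H, _, _, ‹_›, π, k 1, ?_⟩
  ext g
  simp [hπ, hk]

end

/-! ### Positive definiteness in terms of kernels -/

/-- Over `ℂ`, nonnegativity of the quadratic form already forces a matrix to be Hermitian. -/
theorem posSemidef_iff_forall_finset {X : Type u} {K : Matrix X X ℂ} :
    K.PosSemidef ↔ ∀ (s : Finset X) (c : X → ℂ),
      0 ≤ ∑ x ∈ s, ∑ y ∈ s, conj (c x) * K x y * c y := by
  classical
  refine ⟨fun h s c => ?_, fun h => ⟨?_, fun c => h c.support c⟩⟩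
  · have := h.2 (Finsupp.indicator s fun x _ => c x)
    rw [Finsupp.sum_of_support_subset _ (Finsupp.support_indicator_subset s _) _ (by simp)] at this
    convert this using 2 with x hx
    rw [Finsupp.sum_of_support_subset _ (Finsupp.support_indicator_subset s _) _ (by simp)]
    refine Finset.sum_congr rfl fun y hy => ?_
    simp [hx, hy]
  · refine Matrix.IsHermitian.ext fun x y => ?_
    by_cases hxy : x = y
    · subst hxy
      have := (Complex.le_def.1 (h {x} 1)).2
      simp at this
      exact Complex.conj_eq_iff_im.2 this.symm
    -- the vectors `(1, 1)` and `(1, i)` give the imaginary and the real part of the symmetry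
    have h1 := (Complex.le_def.1 (h {x} 1)).2
    have h2 := (Complex.le_def.1 (h {y} 1)).2
    have h3 := (Complex.le_def.1 (h {x, y} 1)).2
    have h4 := (Complex.le_def.1 (h {x, y} (fun z => if z = x then 1 else Complex.I))).2
    have hyx : y ≠ x := Ne.symm hxy
    simp [Finset.sum_pair hxy, hyx] at h1 h2 h3 h4
    apply Complex.ext <;> simp <;> linarith

section

variable {G : Type u} [Group G] [TopologicalSpace G] [IsTopologicalGroup G] [CompactSpace G]

theorem UnitaryRep.isPositiveDefinite_coeff {H : Type v} [NormedAddCommGroup H]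
    [InnerProductSpace ℂ H] [CompleteSpace H] (π : UnitaryRep G H) (x : H) :
    IsPositiveDefinite (π.coeff x) := by
  intro f
  let _ : MeasurableSpace G := borel G
  have hc : Continuous fun g => f g • π.toHom g x := f.continuous.smul (π.continuous_apply x)
  -- the double integral is the squared norm of `∫ f(g) π(g) x dg`
  suffices h : ∫ g, (∫ h, conj (f g) * π.coeff x (g⁻¹ * h) * f h ∂(haar G)) ∂(haar G) =
      inner ℂ (∫ g, f g • π.toHom g x ∂(haar G)) (∫ g, f g • π.toHom g x ∂(haar G)) by
    rw [h, inner_self_eq_norm_sq_to_K]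
    positivity
  have h1 (g : G) : ∫ h, conj (f g) * π.coeff x (g⁻¹ * h) * f h ∂(haar G) =
      inner ℂ (f g • π.toHom g x) (∫ h, f h • π.toHom h x ∂(haar G)) := by
    rw [← integral_inner (𝕜 := ℂ) (integrable_haar hc)]
    congr 1 with h
    simp only [coeff_apply, inner_toHom_inv_mul, inner_smul_left, inner_smul_right]
    ring
  simp only [h1]
  rw [← inner_conj_symm, ← integral_inner (𝕜 := ℂ) (integrable_haar hc), ← integral_conj]
  simp only [inner_conj_symm]

variable [T2Space G]

theorem isPositiveDefinite_iff_posSemidef {φ : C(G, ℂ)} :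
    IsPositiveDefinite φ ↔ (invKernel φ).PosSemidef := by
  refine ⟨fun hφ => posSemidef_iff_forall_finset.2 fun s c => ?_, fun hφ => ?_⟩
  · let Φ (a b : G) : ℂ := ∑ x ∈ s, ∑ y ∈ s, conj (c x) * φ (a⁻¹ * (x⁻¹ * y) * b) * c y
    have hΦ : Continuous fun q : G × G => Φ q.1 q.2 := by fun_prop
    have h1 : Φ 1 1 = ∑ x ∈ s, ∑ y ∈ s, conj (c x) * invKernel φ x y * c y := by
      simp [Φ, invKernel_apply]
    rw [← h1]
    have hcl : IsClosed {z : ℂ | 0 ≤ z} := isClosed_Ici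
    refine hcl.closure_subset (Metric.mem_closure_iff.2 fun ε hε => ?_)
    obtain ⟨V, hV, hVε⟩ : ∃ V ∈ nhds (1 : G), ∀ a ∈ V, ∀ b ∈ V, ‖Φ a b - Φ 1 1‖ ≤ ε / 2 := by
      have h := hΦ.tendsto (1, 1) (Metric.closedBall_mem_nhds (Φ 1 1) (half_pos hε))
      rw [nhds_prod_eq] at h
      obtain ⟨V, hV, hVV⟩ := Filter.mem_prod_self_iff.1 h
      exact ⟨V, hV, fun a ha b hb => by simpa [dist_eq_norm] using hVV (Set.mk_mem_prod ha hb)⟩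
    obtain ⟨u, hu, hu1, huV⟩ := exists_density_of_mem_nhds_one hV
    have hle := norm_integral_density_smul_smul_sub_le hu hu1 huV hΦ hVε
    -- a combination of approximate point masses at the points of `s`
    let f : C(G, ℂ) := ⟨fun g => ∑ x ∈ s, c x * u (x⁻¹ * g), by fun_prop⟩
    have hf : ∫ g, (∫ h, conj (f g) * φ (g⁻¹ * h) * f h ∂(haar G)) ∂(haar G) =
        ∫ a, u a • (∫ b, u b • Φ a b ∂(haar G)) ∂(haar G) := by
      let A (x y g h : G) : ℂ := u (x⁻¹ * g) * u (y⁻¹ * h) * (conj (c x) * φ (g⁻¹ * h) * c y)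
      have hA (x y : G) : Continuous fun q : G × G => A x y q.1 q.2 := by fun_prop
      have hA' (x y g : G) : Continuous (A x y g) := by fun_prop
      have hA'' (x y : G) : Continuous fun g => ∫ h, A x y g h ∂(haar G) :=
        continuous_integral_haar (hA x y)
      have e1 (g h : G) : conj (f g) * φ (g⁻¹ * h) * f h = ∑ x ∈ s, ∑ y ∈ s, A x y g h := by
        simp only [f, A, ContinuousMap.coe_mk, map_sum, map_mul, Complex.conj_ofReal,
          Finset.sum_mul, Finset.mul_sum]
        rw [Finset.sum_comm]
        refine Finset.sum_congr rfl fun x _ => Finset.sum_congr rfl fun y _ => ?_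
        ring
      have e2 (a b : G) : u a • u b • Φ a b = ∑ x ∈ s, ∑ y ∈ s, A x y (x * a) (y * b) := by
        simp only [Φ, A, Finset.smul_sum, Complex.real_smul]
        refine Finset.sum_congr rfl fun x _ => Finset.sum_congr rfl fun y _ => ?_
        simp only [inv_mul_cancel_left, mul_inv_rev, mul_assoc]
      simp only [e1, ← integral_smul, e2]
      have e3 (x y : G) : ∫ g, (∫ h, A x y g h ∂(haar G)) ∂(haar G) =
          ∫ a, (∫ b, A x y (x * a) (y * b) ∂(haar G)) ∂(haar G) := by
        rw [← integral_haar_mul_left _ x]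
        congr 1 with a
        exact (integral_haar_mul_left (A x y (x * a)) y).symm
      have e4 {B : G → G → G → G → ℂ}
          (hB : ∀ x y, Continuous fun q : G × G => B x y q.1 q.2) :
          ∫ g, (∫ h, ∑ x ∈ s, ∑ y ∈ s, B x y g h ∂(haar G)) ∂(haar G) =
            ∑ x ∈ s, ∑ y ∈ s, ∫ g, (∫ h, B x y g h ∂(haar G)) ∂(haar G) := by
        have hB' (x y g : G) : Continuous (B x y g) :=
          (hB x y).comp (by fun_prop : Continuous (Prod.mk g))
        simp_rw [← Finset.sum_product']
        rw [← integral_finsetSum _ fun p _ =>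
          integrable_haar (continuous_integral_haar (hB p.1 p.2))]
        congr 1 with g
        exact integral_finsetSum _ fun p _ => integrable_haar (hB' p.1 p.2 g)
      rw [e4 hA, e4 fun x y => by fun_prop]
      simp only [e3]
    refine ⟨_, hφ f, ?_⟩
    rw [hf, dist_comm, dist_eq_norm]
    exact hle.trans_lt (half_lt_self hε)
  · obtain ⟨H, _, _, _, π, x, rfl⟩ := exists_coeff_eq_of_posSemidef φ hφ
    exact π.isPositiveDefinite_coeff x

end

/-! ### Decomposition into pure functions -/

namespace UnitaryRep

section Restrict

variable {G : Type u} [Group G] [TopologicalSpace G]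
  {H : Type v} [NormedAddCommGroup H] [InnerProductSpace ℂ H] (π : UnitaryRep G H)

/-- The subspace `K` is invariant under the representation. -/
def IsInvariant (K : Submodule ℂ H) : Prop := ∀ g : G, ∀ x ∈ K, π.toHom g x ∈ K

variable {π}

theorem IsInvariant.sup {K L : Submodule ℂ H} (hK : π.IsInvariant K) (hL : π.IsInvariant L) :
    π.IsInvariant (K ⊔ L) := fun g x hx => by
  obtain ⟨y, hy, z, hz, rfl⟩ := Submodule.mem_sup.1 hx
  rw [map_add]
  exact Submodule.add_mem_sup (hK g y hy) (hL g z hz)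

theorem IsInvariant.inf {K L : Submodule ℂ H} (hK : π.IsInvariant K) (hL : π.IsInvariant L) :
    π.IsInvariant (K ⊓ L) := fun g x hx => ⟨hK g x hx.1, hL g x hx.2⟩

theorem IsInvariant.orthogonal {K : Submodule ℂ H} (hK : π.IsInvariant K) : π.IsInvariant Kᗮ := by
  intro g x hx
  rw [Submodule.mem_orthogonal] at hx ⊢
  intro y hy
  rw [inner_toHom_right]
  exact hx _ (hK g⁻¹ y hy)

theorem isInvariant_span_orbit (x : H) :
    π.IsInvariant (Submodule.span ℂ (Set.range fun g => π.toHom g x)) := by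
  intro g y hy
  induction hy using Submodule.span_induction with
  | mem y hy =>
    obtain ⟨h, rfl⟩ := hy
    exact Submodule.subset_span ⟨g * h, by simp only [map_mul]; rfl⟩
  | zero => simp
  | add y z _ _ hy hz => rw [map_add]; exact add_mem hy hz
  | smul c y _ hy => rw [map_smul]; exact Submodule.smul_mem _ _ hy

/-- The subrepresentation on an invariant subspace. -/
def restrict {K : Submodule ℂ H} (hK : π.IsInvariant K) : UnitaryRep G K :=
  ofIsometries (fun g => (π.toHom g).toLinearEquiv.toLinearMap.restrict (hK g))
    (by ext x; simp) (fun g h => by ext x; simp only [map_mul]; rfl)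
    (fun g x => (π.toHom g).norm_map x)
    fun x => (π.continuous_apply (x : H)).subtype_mk _

theorem coeff_smul (c : ℂ) (x : H) : π.coeff (c • x) = (conj c * c) • π.coeff x := by
  ext g
  simp only [coeff_apply, map_smul, inner_smul_left, inner_smul_right, ContinuousMap.smul_apply,
    smul_eq_mul]
  ring

/-- Orthogonal invariant subspaces contribute to a diagonal coefficient additively. -/
theorem coeff_add_of_mem_orthogonal {K : Submodule ℂ H} (hK : π.IsInvariant K) {x y : H}
    (hx : x ∈ K) (hy : y ∈ Kᗮ) : π.coeff (x + y) = π.coeff x + π.coeff y := by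
  ext g
  have h1 : inner ℂ x (π.toHom g y) = 0 := hK.orthogonal g y hy x hx
  have h2 : inner ℂ y (π.toHom g x) = 0 := Submodule.inner_left_of_mem_orthogonal (hK g x hx) hy
  simp only [coeff_apply, map_add, inner_add_left, inner_add_right, h1, h2,
    ContinuousMap.add_apply, add_zero, zero_add]

theorem continuous_coeff [CompactSpace G] : Continuous fun x => π.coeff x := by
  refine ContinuousMap.continuous_of_continuous_uncurry _ ?_
  -- for isometries, strong continuity is joint continuity
  have h : Continuous fun q : H × G => π.toHom q.2 q.1 := by
    refine continuous_iff_continuousAt.2 fun ⟨x, g⟩ => ?_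
    rw [ContinuousAt, tendsto_iff_norm_sub_tendsto_zero]
    refine squeeze_zero (fun _ => norm_nonneg _)
      (g := fun q : H × G => ‖q.1 - x‖ + ‖π.toHom q.2 x - π.toHom g x‖) (fun q => ?_) ?_
    · rw [← (π.toHom q.2).norm_map (q.1 - x), map_sub]
      exact norm_sub_le_norm_sub_add_norm_sub _ _ _
    · have hc : Continuous fun q : H × G => ‖q.1 - x‖ + ‖π.toHom q.2 x - π.toHom g x‖ := by
        have := (π.continuous_apply x).comp (continuous_snd (X := H))
        fun_prop
      simpa using hc.tendsto (x, g)
  exact continuous_fst.inner h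

theorem continuous_rankOne_orbit (π : UnitaryRep G H) (v : H) :
    Continuous fun g => InnerProductSpace.rankOne ℂ (π.toHom g v) (π.toHom g v) := by
  have h := π.continuous_apply v
  exact (ContinuousLinearMap.smulRightL ℂ H H).continuous₂.comp
    (((innerSL ℂ).continuous.comp h).prodMk h)

end Restrict

section Irreducible

variable {G : Type u} [Group G] [TopologicalSpace G] [IsTopologicalGroup G] [CompactSpace G]
  {H : Type u} [NormedAddCommGroup H] [InnerProductSpace ℂ H] {π : UnitaryRep G H}

/-- In a finite-dimensional irreducible representation every unit vector has a pure coefficient. -/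
theorem coeff_mem_pureOne [FiniteDimensional ℂ H]
    (hirr : ∀ K : Submodule ℂ H, π.IsInvariant K → K = ⊥ ∨ K = ⊤) {x : H} (hx : ‖x‖ = 1) :
    π.coeff x ∈ PureOne G := by
  have hx0 : x ≠ 0 := fun h => by simp [h] at hx
  have : CompleteSpace H := FiniteDimensional.complete ℂ H
  refine ⟨⟨π.isPositiveDefinite_coeff x, ?_⟩, H, _, _, this, π, x, ?_, fun g => rfl,
    ⟨x, 0, hx0⟩, fun K _ hK => hirr K hK⟩
  · simp [inner_self_eq_norm_sq_to_K, hx]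
  · have hmem : x ∈ Submodule.span ℂ (Set.range fun g => π.toHom g x) :=
      Submodule.subset_span ⟨1, by simp⟩
    have h := (hirr _ (isInvariant_span_orbit x)).resolve_left
      fun h => hx0 ((Submodule.eq_bot_iff _).1 h x hmem)
    rw [IsCyclicVector, h]
    exact dense_univ

/-- Coefficients of finite-dimensional unitary representations are conical combinations of pure
functions: split off invariant subspaces until they are irreducible. -/
theorem coeff_mem_span_pureOne {E : Submodule ℂ H} [hE : FiniteDimensional ℂ E]
    (hinv : π.IsInvariant E) {x : H} (hx : x ∈ E) :
    π.coeff x ∈ Submodule.span NNReal (PureOne G) := by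
  induction hn : Module.finrank ℂ E using Nat.strong_induction_on generalizing E x with
  | _ n ih =>
  by_cases hx0 : x = 0
  · have : π.coeff x = 0 := by ext g; simp [hx0]
    rw [this]
    exact zero_mem _
  by_cases hirr : ∀ K ≤ E, π.IsInvariant K → K = ⊥ ∨ K = E
  · have hirr' : ∀ K : Submodule ℂ E, (restrict hinv).IsInvariant K → K = ⊥ ∨ K = ⊤ := by
      intro K hK
      have hmap : π.IsInvariant (K.map E.subtype) := by
        rintro g _ ⟨y, hy, rfl⟩
        exact ⟨_, hK g y hy, rfl⟩
      rcases hirr _ (Submodule.map_subtype_le E K) hmap with h | h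
      · exact Or.inl (Submodule.map_injective_of_injective E.injective_subtype (by simpa using h))
      · refine Or.inr (Submodule.map_injective_of_injective E.injective_subtype ?_)
        rw [h, Submodule.map_subtype_top]
    have hnx : ‖x‖ ≠ 0 := norm_ne_zero_iff.2 hx0
    let y : E := (‖x‖⁻¹ : ℂ) • ⟨x, hx⟩
    have hy : ‖y‖ = 1 := by
      simp [y, norm_smul, hnx]
    have hxy : π.coeff x = (‖x‖₊ ^ 2 : NNReal) • (restrict hinv).coeff y := by
      rw [coeff_smul]
      ext g
      have : (‖x‖ : ℂ) ≠ 0 := by exact_mod_cast hnx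
      simp [NNReal.smul_def]
      field_simp
      rfl
    rw [hxy]
    exact Submodule.smul_mem _ _ (Submodule.subset_span (coeff_mem_pureOne hirr' hy))
  · push Not at hirr
    obtain ⟨K, hKE, hK, hK0, hK1⟩ := hirr
    have hfin : FiniteDimensional ℂ K := Submodule.finiteDimensional_of_le hKE
    have hlt : Module.finrank ℂ K < n := hn ▸ Submodule.finrank_lt_finrank_of_lt (hKE.lt_of_ne hK1)
    have hlt' : Module.finrank ℂ (Kᗮ ⊓ E : Submodule ℂ H) < n := by
      refine hn ▸ Submodule.finrank_lt_finrank_of_lt (inf_le_right.lt_of_ne fun h => hK0 ?_)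
      rw [Submodule.eq_bot_iff]
      intro z hz
      have : z ∈ Kᗮ := (h.symm ▸ hKE hz : z ∈ Kᗮ ⊓ E).1
      exact inner_self_eq_zero.1 (this z hz)
    have hfin' : FiniteDimensional ℂ (Kᗮ ⊓ E : Submodule ℂ H) :=
      Submodule.finiteDimensional_of_le inf_le_right
    have hy : K.starProjection x ∈ K := Submodule.starProjection_apply_mem _ _
    have hz : x - K.starProjection x ∈ Kᗮ := Submodule.sub_starProjection_mem_orthogonal x
    rw [← add_sub_cancel (K.starProjection x) x, coeff_add_of_mem_orthogonal hK hy hz]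
    exact add_mem (ih _ hlt hK hy rfl)
      (ih _ hlt' (hK.orthogonal.inf hinv) ⟨hz, sub_mem hx (hKE hy)⟩ rfl)

end Irreducible

section Average

variable {G : Type u} [Group G] [TopologicalSpace G] [IsTopologicalGroup G] [CompactSpace G]
  {H : Type v} [NormedAddCommGroup H] [InnerProductSpace ℂ H] (π : UnitaryRep G H)

/-- The average `∫ |π(g) v⟩⟨π(g) v| dg` of the orbit of a rank one operator. -/
def averageRankOne (v : H) : H →L[ℂ] H :=
  ∫ g, InnerProductSpace.rankOne ℂ (π.toHom g v) (π.toHom g v) ∂(haar G)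

variable [CompleteSpace H]

theorem averageRankOne_apply (v w : H) :
    π.averageRankOne v w = ∫ g, inner ℂ (π.toHom g v) w • π.toHom g v ∂(haar G) := by
  have := integral_haar_clm_comp (ContinuousLinearMap.apply ℂ H w) (π.continuous_rankOne_orbit v)
  exact this.symm

/-- The average is a norm limit of finite rank operators. -/
theorem isCompactOperator_averageRankOne (v : H) : IsCompactOperator (π.averageRankOne v) := by
  let _ : MeasurableSpace G := borel G
  refine Convex.integral_mem (s := {T : H →L[ℂ] H | IsCompactOperator T}) (μ := haar G) ?_
    isClosed_setOfPred_isCompactOperator (Filter.Eventually.of_forall fun g => ?_)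
    (integrable_haar (π.continuous_rankOne_orbit v))
  · exact fun S hS T hT a b _ _ _ => (hS.smul a).add (hT.smul b)
  · change IsCompactOperator (InnerProductSpace.rankOne ℂ (π.toHom g v) (π.toHom g v))
    rw [InnerProductSpace.rankOne_def']
    exact (isCompactOperator_of_locallyCompactSpace_dom (innerSL ℂ (π.toHom g v))).clm_comp
      (ContinuousLinearMap.toSpanSingleton ℂ (π.toHom g v))

theorem inner_averageRankOne (v x y : H) :
    inner ℂ x (π.averageRankOne v y) =
      ∫ g, inner ℂ (π.toHom g v) y * inner ℂ x (π.toHom g v) ∂(haar G) := by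
  let _ : MeasurableSpace G := borel G
  have := π.continuous_apply v
  rw [averageRankOne_apply, ← integral_inner (𝕜 := ℂ) (integrable_haar (by fun_prop))]
  simp only [inner_smul_right]

theorem isSymmetric_averageRankOne (v : H) : (π.averageRankOne v).IsSymmetric := by
  intro x y
  change inner ℂ (π.averageRankOne v x) y = inner ℂ x (π.averageRankOne v y)
  let _ : MeasurableSpace G := borel G
  rw [← inner_conj_symm, inner_averageRankOne, inner_averageRankOne]
  rw [← integral_conj]
  simp only [map_mul, inner_conj_symm, mul_comm]

theorem averageRankOne_toHom (v x : H) (h : G) :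
    π.averageRankOne v (π.toHom h x) = π.toHom h (π.averageRankOne v x) := by
  have hv := π.continuous_apply v
  rw [averageRankOne_apply, averageRankOne_apply, ← integral_haar_mul_left _ h]
  have := integral_haar_clm_comp (π.toHom h : H →L[ℂ] H)
    (f := fun g => inner ℂ (π.toHom g v) x • π.toHom g v) (by fun_prop)
  refine Eq.trans ?_ this
  congr 1 with g
  simp [map_mul]

/-- The kernel of the average is orthogonal to the whole orbit of `v`, since
`⟪w, A w⟫ = ∫ |⟪π(g) v, w⟫|² dg`. -/
theorem inner_eq_zero_of_averageRankOne_eq_zero {v w : H} (h : π.averageRankOne v w = 0) :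
    inner ℂ v w = 0 := by
  let _ : MeasurableSpace G := borel G
  have hv := π.continuous_apply v
  have h1 : ∫ g, ‖inner ℂ (π.toHom g v) w‖ ^ 2 ∂(haar G) = 0 := by
    have h2 := π.inner_averageRankOne v w w
    rw [h, inner_zero_right] at h2
    have h3 (g : G) : inner ℂ (π.toHom g v) w * inner ℂ w (π.toHom g v) =
        ((‖inner ℂ (π.toHom g v) w‖ ^ 2 : ℝ) : ℂ) := by
      rw [← inner_conj_symm w, Complex.mul_conj, Complex.normSq_eq_norm_sq]
    simp only [h3] at h2
    rw [integral_complex_ofReal] at h2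
    exact_mod_cast h2.symm
  have h4 := eq_zero_of_integral_haar_eq_zero (by fun_prop) (fun g => by positivity) h1 1
  simpa using h4

/-- Every vector is a limit of vectors that lie in finite-dimensional invariant subspaces, namely
in sums of eigenspaces of its averaged rank one operator for nonzero eigenvalues. -/
theorem exists_mem_finiteDimensional_isInvariant_dist_lt (v : H) {ε : ℝ} (hε : 0 < ε) :
    ∃ (E : Submodule ℂ H) (w : H), FiniteDimensional ℂ E ∧ π.IsInvariant E ∧ w ∈ E ∧
      dist v w < ε := by
  set A := π.averageRankOne v with hA
  have hcomp : IsCompactOperator A := π.isCompactOperator_averageRankOne v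
  have hsymm : A.IsSymmetric := π.isSymmetric_averageRankOne v
  let S : Submodule ℂ H := ⨆ μ : {μ : ℂ // μ ≠ 0}, Module.End.eigenspace (A : Module.End ℂ H) μ
  have hv : v ∈ Sᗮᗮ := by
    rw [Submodule.mem_orthogonal']
    intro w hw
    refine π.inner_eq_zero_of_averageRankOne_eq_zero ?_
    -- `A w` is orthogonal to every eigenspace
    have h : A w ∈ (⨆ μ, Module.End.eigenspace (A : Module.End ℂ H) μ)ᗮ := by
      rw [← Submodule.iInf_orthogonal, Submodule.mem_iInf]
      intro μ x hx
      have hx' : A x = μ • x := Module.End.mem_eigenspace_iff.1 hx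
      have hs : inner ℂ (A x) w = inner ℂ x (A w) := hsymm x w
      rw [← hs, hx', inner_smul_left]
      by_cases hμ : μ = 0
      · simp [hμ]
      · have : x ∈ S := Submodule.mem_iSup_of_mem (⟨μ, hμ⟩ : {μ : ℂ // μ ≠ 0}) hx
        rw [hw x this, mul_zero]
    rw [ContinuousLinearMap.orthogonalComplement_iSup_eigenspaces_eq_bot hcomp hsymm] at h
    exact h
  rw [Submodule.orthogonal_orthogonal_eq_closure] at hv
  obtain ⟨w, hw, hvw⟩ := Metric.mem_closure_iff.1 hv ε hε
  suffices h : ∃ E : Submodule ℂ H, FiniteDimensional ℂ E ∧ π.IsInvariant E ∧ w ∈ E by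
    obtain ⟨E, hE, hinv, hwE⟩ := h
    exact ⟨E, w, hE, hinv, hwE, hvw⟩
  refine Submodule.iSup_induction _
    (motive := fun w => ∃ E : Submodule ℂ H, FiniteDimensional ℂ E ∧ π.IsInvariant E ∧ w ∈ E) hw
    (fun μ x hx => ⟨_, ContinuousLinearMap.finite_dimensional_eigenspace hcomp μ μ.2,
      fun g y hy => ?_, hx⟩)
    ⟨⊥, inferInstance, fun g x hx => by simp [(Submodule.mem_bot ℂ).1 hx], zero_mem _⟩ ?_
  · have hy' : A y = (μ : ℂ) • y := Module.End.mem_eigenspace_iff.1 hy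
    rw [Module.End.mem_eigenspace_iff]
    change A (π.toHom g y) = _
    rw [hA, averageRankOne_toHom, ← hA, hy', map_smul]
  · rintro x y ⟨E, hE, hEi, hx⟩ ⟨F, hF, hFi, hy⟩
    exact ⟨E ⊔ F, inferInstance, hEi.sup hFi, Submodule.add_mem_sup hx hy⟩

end Average

end UnitaryRep

section

variable {G : Type u} [Group G] [TopologicalSpace G] [IsTopologicalGroup G] [CompactSpace G]
  [T2Space G]

/-- The Peter–Weyl theorem for positive definite functions. -/
theorem IsPositiveDefinite.mem_closure_span_pureOne {φ : C(G, ℂ)} (hφ : IsPositiveDefinite φ) :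
    φ ∈ closure (Submodule.span NNReal (PureOne G) : Set C(G, ℂ)) := by
  obtain ⟨H, _, _, _, π, v, rfl⟩ :=
    exists_coeff_eq_of_posSemidef φ (isPositiveDefinite_iff_posSemidef.1 hφ)
  have hv : v ∈ closure {w | π.coeff w ∈ Submodule.span NNReal (PureOne G)} := by
    refine Metric.mem_closure_iff.2 fun ε hε => ?_
    obtain ⟨E, w, hE, hinv, hw, hvw⟩ := π.exists_mem_finiteDimensional_isInvariant_dist_lt v hε
    exact ⟨w, UnitaryRep.coeff_mem_span_pureOne hinv hw, hvw⟩
  exact map_mem_closure UnitaryRep.continuous_coeff hv fun w hw => hw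

end

/-! ### Operations on positive definite functions -/

section PositiveDefinite

variable {G : Type u} [Group G] [TopologicalSpace G] [IsTopologicalGroup G] [CompactSpace G]
  {G' : Type v} [Group G'] [TopologicalSpace G'] [IsTopologicalGroup G'] [CompactSpace G']

theorem integral_nonneg_of_mem_PD {φ : C(G, ℂ)} (hφ : φ ∈ PD G) : 0 ≤ ∫ g, φ g ∂(haar G) := by
  have h := hφ 1
  have h1 (g : G) : ∫ h, φ (g⁻¹ * h) ∂(haar G) = ∫ h, φ h ∂(haar G) :=
    integral_haar_mul_left φ g⁻¹
  simpa [h1] using h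

/-- The correlation `x ↦ ∫ conj (f s) f'(s x) ds`. -/
def correlation (f f' : C(G, ℂ)) : C(G, ℂ) where
  toFun x := ∫ s, conj (f s) * f' (s * x) ∂(haar G)
  continuous_toFun := continuous_integral_haar (F := fun x s => conj (f s) * f' (s * x))
    (by fun_prop)

theorem correlation_apply (f f' : C(G, ℂ)) (x : G) :
    correlation f f' x = ∫ s, conj (f s) * f' (s * x) ∂(haar G) := rfl

theorem correlation_sum_sum {ι : Type*} (s : Finset ι) (c : ι → ℂ) (f : ι → C(G, ℂ)) :
    correlation (∑ i ∈ s, c i • f i) (∑ i ∈ s, c i • f i) =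
      ∑ i ∈ s, ∑ j ∈ s, (conj (c i) * c j) • correlation (f i) (f j) := by
  ext x
  simp only [ContinuousMap.sum_apply, ContinuousMap.smul_apply, correlation_apply,
    ← integral_smul]
  simp_rw [← Finset.sum_product']
  rw [← integral_finsetSum _ fun p _ => integrable_haar (by fun_prop)]
  congr 1 with t
  simp only [smul_eq_mul, map_sum, map_mul, Finset.sum_mul_sum, Finset.sum_product]
  refine Finset.sum_congr rfl fun i _ => Finset.sum_congr rfl fun j _ => ?_
  ring

variable [T2Space G] [T2Space G']

theorem mem_PD_iff {φ : C(G, ℂ)} : φ ∈ PD G ↔ (invKernel φ).PosSemidef :=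
  isPositiveDefinite_iff_posSemidef

theorem mem_PD_iff_forall_finset {φ : C(G, ℂ)} :
    φ ∈ PD G ↔ ∀ (s : Finset G) (c : G → ℂ),
      0 ≤ ∑ x ∈ s, ∑ y ∈ s, conj (c x) * φ (x⁻¹ * y) * c y := by
  rw [mem_PD_iff, posSemidef_iff_forall_finset]
  rfl

theorem isClosed_PD : IsClosed (PD G) := by
  have : PD G = ⋂ (s : Finset G) (c : G → ℂ),
      {φ : C(G, ℂ) | 0 ≤ ∑ x ∈ s, ∑ y ∈ s, conj (c x) * φ (x⁻¹ * y) * c y} := by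
    ext φ
    simp only [mem_PD_iff_forall_finset, Set.mem_iInter, Set.mem_ofPred_eq]
  rw [this]
  exact isClosed_iInter fun s => isClosed_iInter fun c => isClosed_le (by fun_prop) (by fun_prop)

theorem sum_smul_mem_PD {ι : Type*} (s : Finset ι) {p : ι → ℝ} (hp : ∀ i, 0 ≤ p i)
    {φ : ι → C(G, ℂ)} (hφ : ∀ i, φ i ∈ PD G) : ∑ i ∈ s, (p i : ℂ) • φ i ∈ PD G := by
  classical
  induction s using Finset.induction_on with
  | empty => simp [mem_PD_iff_forall_finset]
  | insert i s hi ih =>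
    rw [Finset.sum_insert hi]
    rw [mem_PD_iff] at ih ⊢
    exact ((mem_PD_iff.1 (hφ i)).smul (by exact_mod_cast hp i : (0 : ℂ) ≤ p i)).add ih

/-- The Schur product theorem for functions on a product group. -/
theorem tmul_mem_PD {f : C(G, ℂ)} (hf : f ∈ PD G) {ξ : C(G', ℂ)} (hξ : ξ ∈ PD G') :
    tmul f ξ ∈ PD (G × G') :=
  mem_PD_iff.2 (((mem_PD_iff.1 hf).submatrix Prod.fst).hadamard
    ((mem_PD_iff.1 hξ).submatrix Prod.snd))

theorem comp_diag_mem_PD {φ : C(G × G, ℂ)} (hφ : φ ∈ PD (G × G)) :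
    φ.comp ⟨fun x => (x, x), by fun_prop⟩ ∈ PD G :=
  mem_PD_iff.2 ((mem_PD_iff.1 hφ).submatrix fun x => (x, x))

theorem conj_apply_inv_of_mem_PD {φ : C(G, ℂ)} (hφ : φ ∈ PD G) (g : G) :
    conj (φ g⁻¹) = φ g := by
  have := (mem_PD_iff.1 hφ).isHermitian.apply 1 g
  simpa [invKernel_apply] using this

/-- A continuous functional that is nonnegative on pure functions is nonnegative on all positive
definite functions. -/
theorem nonneg_of_forall_pureOne (L : C(G, ℂ) →L[ℂ] ℂ) (hL : ∀ ψ ∈ PureOne G, 0 ≤ L ψ)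
    {φ : C(G, ℂ)} (hφ : φ ∈ PD G) : 0 ≤ L φ := by
  have hcl : IsClosed {ψ | 0 ≤ L ψ} := isClosed_le continuous_const L.continuous
  refine closure_minimal (fun ψ hψ => ?_) hcl (IsPositiveDefinite.mem_closure_span_pureOne hφ)
  induction hψ using Submodule.span_induction with
  | mem ψ hψ => exact hL ψ hψ
  | zero => simp
  | add ψ χ _ _ h1 h2 =>
    change 0 ≤ L (ψ + χ)
    rw [map_add]
    exact add_nonneg h1 h2
  | smul c ψ _ h =>
    have : c • ψ = ((c : ℝ) : ℂ) • ψ := by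
      ext g
      simp [NNReal.smul_def]
    change 0 ≤ L (c • ψ)
    rw [this, map_smul]
    exact mul_nonneg (by exact_mod_cast c.2) h

/-- Autocorrelations are the diagonal coefficients of the right regular representation. -/
theorem correlation_self_mem_PD (f : C(G, ℂ)) : correlation f f ∈ PD G := by
  refine mem_PD_iff_forall_finset.2 fun s c => ?_
  have h : ∑ x ∈ s, ∑ y ∈ s, conj (c x) * correlation f f (x⁻¹ * y) * c y =
      ∫ t, ((‖∑ x ∈ s, c x * f (t * x)‖ ^ 2 : ℝ) : ℂ) ∂(haar G) := by
    have h1 (x y : G) : conj (c x) * correlation f f (x⁻¹ * y) * c y =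
        ∫ t, conj (c x * f (t * x)) * (c y * f (t * y)) ∂(haar G) := by
      rw [correlation_apply, ← integral_haar_mul_right (by fun_prop) x, ← integral_const_mul,
        ← integral_mul_const]
      congr 1 with t
      rw [map_mul (starRingEnd ℂ), mul_assoc t, mul_inv_cancel_left]
      ring
    simp only [h1]
    simp_rw [← Finset.sum_product']
    rw [← integral_finsetSum _ fun p _ => integrable_haar (by fun_prop)]
    congr 1 with t
    rw [← Complex.normSq_eq_norm_sq, Complex.normSq_eq_conj_mul_self, map_sum, Finset.sum_mul_sum,
      Finset.sum_product]
  let _ : MeasurableSpace G := borel G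
  rw [h, integral_complex_ofReal]
  exact_mod_cast integral_nonneg fun t => by positivity

end PositiveDefinite

section Tmul

variable {X : Type u} [TopologicalSpace X] [CompactSpace X]
  {Y : Type v} [TopologicalSpace Y] [CompactSpace Y]

/-- The product function `f ⊗ ξ` as a bounded bilinear map. -/
def tmulL : C(X, ℂ) →L[ℂ] C(Y, ℂ) →L[ℂ] C(X × Y, ℂ) :=
  LinearMap.mkContinuous₂
    (LinearMap.mk₂ ℂ tmul
      (fun f f' ξ => by ext q; simp [tmul, add_mul])
      (fun c f ξ => by ext q; simp [tmul, mul_assoc])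
      (fun f ξ ξ' => by ext q; simp [tmul, mul_add])
      (fun c f ξ => by ext q; simp [tmul, mul_left_comm])) 1
    (fun f ξ => by
      rw [one_mul]
      refine (ContinuousMap.norm_le _ (by positivity)).2 fun q => ?_
      exact (norm_mul_le _ _).trans (mul_le_mul (f.norm_coe_le_norm _) (ξ.norm_coe_le_norm _)
        (norm_nonneg _) (norm_nonneg _)))

theorem tmulL_apply (f : C(X, ℂ)) (ξ : C(Y, ℂ)) : tmulL f ξ = tmul f ξ := rfl

end Tmul

/-! ### Separating functionals and the operators they define -/

section Hermitian

variable {G : Type u} [Group G] [TopologicalSpace G] [IsTopologicalGroup G] [CompactSpace G]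

/-- The functional `ψ ↦ ℓ(ψ) + conj (ℓ(ψ*))`, where `ψ*(g) = conj (ψ(g⁻¹))`. -/
def twiceHermitianPart (ℓ : C(G, ℂ) →L[ℂ] ℂ) : C(G, ℂ) →L[ℂ] ℂ where
  toFun ψ := ℓ ψ + conj (ℓ (star (ψ.comp ⟨fun g => g⁻¹, continuous_inv⟩)))
  map_add' ψ χ := by
    have : star ((ψ + χ).comp ⟨fun g : G => g⁻¹, continuous_inv⟩) =
        star (ψ.comp ⟨fun g => g⁻¹, continuous_inv⟩) +
          star (χ.comp ⟨fun g => g⁻¹, continuous_inv⟩) := by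
      ext q; simp
    rw [this, map_add, map_add, map_add]
    ring
  map_smul' c ψ := by
    have : star ((c • ψ).comp ⟨fun g : G => g⁻¹, continuous_inv⟩) =
        conj c • star (ψ.comp ⟨fun g => g⁻¹, continuous_inv⟩) := by
      ext q; simp
    rw [this, map_smul, map_smul, smul_eq_mul, smul_eq_mul, map_mul, Complex.conj_conj]
    simp [mul_add]
  cont := by
    have := ContinuousMap.continuous_precomp (Z := ℂ) (⟨fun g : G => g⁻¹, continuous_inv⟩ : C(G, G))
    fun_prop

theorem twiceHermitianPart_apply_of_mem_PD [T2Space G] (ℓ : C(G, ℂ) →L[ℂ] ℂ) {ψ : C(G, ℂ)}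
    (hψ : ψ ∈ PD G) : twiceHermitianPart ℓ ψ = ((2 * (ℓ ψ).re : ℝ) : ℂ) := by
  have h : star (ψ.comp ⟨fun g => g⁻¹, continuous_inv⟩) = ψ := by
    ext q
    exact conj_apply_inv_of_mem_PD hψ q
  change ℓ ψ + conj (ℓ (star (ψ.comp ⟨fun g => g⁻¹, continuous_inv⟩))) = _
  rw [h, Complex.add_conj]

end Hermitian

section Separation

variable {G₁ : Type u} [Group G₁] [TopologicalSpace G₁] [IsTopologicalGroup G₁] [CompactSpace G₁]
  [T2Space G₁]
  {G₂ : Type v} [Group G₂] [TopologicalSpace G₂] [IsTopologicalGroup G₂] [CompactSpace G₂]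
  [T2Space G₂]

theorem convexHull_tmul_pureOne_subset_sepZero :
    convexHull ℝ (Set.image2 tmul (PureOne G₁) (PureOne G₂)) ⊆ SepZero G₁ G₂ := by
  intro φ hφ
  obtain ⟨ι, _, p, ψ, hp, hp1, hψ, rfl⟩ := mem_convexHull_iff_exists_fintype.1 hφ
  choose ε hε η hη hψ using hψ
  have hval (g₁ : G₁) (g₂ : G₂) :
      (∑ i, p i • ψ i) (g₁, g₂) = ∑ i, (p i : ℂ) * (ε i g₁ * η i g₂) := by
    simp [← hψ, tmul]
  refine ⟨⟨?_, ?_⟩, Fintype.card ι, p ∘ (Fintype.equivFin ι).symm, ε ∘ (Fintype.equivFin ι).symm,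
    η ∘ (Fintype.equivFin ι).symm, fun m => hp _, ?_, fun m => hε _, fun m => hη _,
    fun g₁ g₂ => ?_⟩
  · have h := sum_smul_mem_PD Finset.univ hp
      fun i => (hψ i ▸ tmul_mem_PD (hε i).1.1 (hη i).1.1 : ψ i ∈ PD (G₁ × G₂))
    convert h using 2 with i
    ext g
    simp
  · rw [Prod.one_eq_mk, hval]
    simp only [(hε _).1.2, (hη _).1.2, mul_one]
    exact_mod_cast hp1
  · rw [← hp1]
    exact (Fintype.equivFin ι).symm.sum_comp p
  · rw [hval]
    exact ((Fintype.equivFin ι).symm.sum_comp fun i => (p i : ℂ) * (ε i g₁ * η i g₂)).symm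

theorem nonneg_tmul_of_forall_pureOne (ℓ : C(G₁ × G₂, ℂ) →L[ℂ] ℂ)
    (h : ∀ ε ∈ PureOne G₁, ∀ η ∈ PureOne G₂, 0 ≤ ℓ (tmul ε η)) :
    ∀ f ∈ PD G₁, ∀ ξ ∈ PD G₂, 0 ≤ ℓ (tmul f ξ) := by
  intro f hf ξ hξ
  have h1 (ε : C(G₁, ℂ)) (hε : ε ∈ PureOne G₁) : 0 ≤ ℓ (tmul ε ξ) := by
    simpa [tmulL_apply] using nonneg_of_forall_pureOne (ℓ.comp (tmulL ε))
      (fun η hη => by simpa [tmulL_apply] using h ε hε η hη) hξ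
  simpa [tmulL_apply] using nonneg_of_forall_pureOne (ℓ.comp (tmulL.flip ξ))
    (fun ε hε => by simpa [tmulL_apply] using h1 ε hε) hf

/-- A normalized positive definite function that is not separable is detected by a functional that
is nonnegative on products of positive definite functions. -/
theorem exists_functional_of_notMem_sep {φ : C(G₁ × G₂, ℂ)} (hφ : φ ∈ PDOne (G₁ × G₂))
    (hsep : φ ∉ Sep G₁ G₂) :
    ∃ ℓ : C(G₁ × G₂, ℂ) →L[ℂ] ℂ,
      (∀ f ∈ PD G₁, ∀ ξ ∈ PD G₂, 0 ≤ ℓ (tmul f ξ)) ∧ ¬ 0 ≤ ℓ φ := by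
  let S : Set C(G₁ × G₂, ℂ) := Set.image2 tmul (PureOne G₁) (PureOne G₂)
  have hφS : φ ∉ closure (convexHull ℝ S) := fun h =>
    hsep ⟨hφ, closure_mono convexHull_tmul_pureOne_subset_sepZero h⟩
  obtain ⟨f, r, hf, hfφ⟩ := RCLike.geometric_hahn_banach_closed_point (𝕜 := ℂ)
    (convex_convexHull ℝ S).closure isClosed_closure hφS
  -- `r - re f` is linear on normalized functions; `ℓ` is twice its Hermitian part
  let ℓ₀ : C(G₁ × G₂, ℂ) →L[ℂ] ℂ := (r : ℂ) • ContinuousMap.evalCLM ℂ 1 - f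
  have hℓ₀ (ψ : C(G₁ × G₂, ℂ)) (hψ : ψ 1 = 1) : (ℓ₀ ψ).re = r - (f ψ).re := by
    simp [ℓ₀, hψ]
  let ℓ := twiceHermitianPart ℓ₀
  have hℓ {ψ : C(G₁ × G₂, ℂ)} (hψ : ψ ∈ PDOne (G₁ × G₂)) :
      ℓ ψ = ((2 * (r - (f ψ).re) : ℝ) : ℂ) := by
    rw [twiceHermitianPart_apply_of_mem_PD ℓ₀ hψ.1, hℓ₀ ψ hψ.2]
  refine ⟨ℓ, nonneg_tmul_of_forall_pureOne ℓ fun ε hε η hη => ?_, fun h => ?_⟩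
  · have hmem : tmul ε η ∈ convexHull ℝ S := subset_convexHull ℝ S ⟨ε, hε, η, hη, rfl⟩
    have hlt := hf _ (subset_closure hmem)
    rw [hℓ (convexHull_tmul_pureOne_subset_sepZero hmem).1]
    have : (f (tmul ε η)).re < r := hlt
    have : 0 ≤ 2 * (r - (f (tmul ε η)).re) := by linarith
    exact_mod_cast this
  · rw [hℓ hφ] at h
    have h' : 0 ≤ 2 * (r - (f φ).re) := by exact_mod_cast h
    have : r < (f φ).re := hfφ
    linarith

end Separation

section Witness

variable {G₁ : Type u} [Group G₁] [TopologicalSpace G₁] [IsTopologicalGroup G₁]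

/-- The left translates `s ↦ f (g⁻¹ s)` of a function. -/
def leftTranslate (f : C(G₁, ℂ)) (g : G₁) : C(G₁, ℂ) := f.comp ⟨fun s => g⁻¹ * s, by fun_prop⟩

theorem leftTranslate_apply (f : C(G₁, ℂ)) (g s : G₁) : leftTranslate f g s = f (g⁻¹ * s) := rfl

variable [CompactSpace G₁] {Y : Type v} [TopologicalSpace Y] [CompactSpace Y]

theorem correlation_leftTranslate (f : C(G₁, ℂ)) (x y : G₁) :
    correlation (leftTranslate f x) (leftTranslate f y) =
      correlation f (leftTranslate f (x⁻¹ * y)) := by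
  ext z
  rw [correlation_apply, ← integral_haar_mul_left _ x]
  simp [correlation_apply, leftTranslate_apply, mul_assoc]

theorem continuous_correlation_leftTranslate (f : C(G₁, ℂ)) :
    Continuous fun g => correlation f (leftTranslate f g) := by
  refine ContinuousMap.continuous_of_continuous_uncurry _ ?_
  exact continuous_integral_haar (X := G₁ × G₁)
    (F := fun q s => conj (f s) * f (q.1⁻¹ * (s * q.2))) (by fun_prop)

/-- The operator `ξ ↦ (g ↦ ℓ (a_g ⊗ ξ))` attached to a functional `ℓ` on `C(G₁ × Y)`, where
`a_g` is the correlation of `f` with its translate by `g`.  If `f` is concentrated near `1`, then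
`a_g` approximates the point mass at `g`. -/
def smearedSlice (f : C(G₁, ℂ)) (ℓ : C(G₁ × Y, ℂ) →L[ℂ] ℂ) : C(Y, ℂ) →L[ℂ] C(G₁, ℂ) where
  toFun ξ := ⟨fun g => ℓ (tmulL (correlation f (leftTranslate f g)) ξ), by
    have := continuous_correlation_leftTranslate f
    fun_prop⟩
  map_add' ξ ξ' := by ext g; simp
  map_smul' c ξ := by ext g; simp
  cont := by
    refine ContinuousMap.continuous_of_continuous_uncurry _ ?_
    have := (continuous_correlation_leftTranslate f).comp (continuous_snd (X := C(Y, ℂ)))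
    change Continuous fun q : C(Y, ℂ) × G₁ =>
      ℓ (tmulL (correlation f (leftTranslate f q.2)) q.1)
    fun_prop

theorem smearedSlice_apply (f : C(G₁, ℂ)) (ℓ : C(G₁ × Y, ℂ) →L[ℂ] ℂ) (ξ : C(Y, ℂ)) (g : G₁) :
    smearedSlice f ℓ ξ g = ℓ (tmul (correlation f (leftTranslate f g)) ξ) := rfl

variable {G₂ : Type v} [Group G₂] [TopologicalSpace G₂] [IsTopologicalGroup G₂] [CompactSpace G₂]
  [T2Space G₁]

theorem preservesPD_smearedSlice (f : C(G₁, ℂ)) {ℓ : C(G₁ × G₂, ℂ) →L[ℂ] ℂ}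
    (hℓ : ∀ f ∈ PD G₁, ∀ ξ ∈ PD G₂, 0 ≤ ℓ (tmul f ξ)) : PreservesPD (smearedSlice f ℓ) := by
  intro ξ hξ
  refine mem_PD_iff_forall_finset.2 fun s c => ?_
  have h : ∑ x ∈ s, ∑ y ∈ s, conj (c x) * smearedSlice f ℓ ξ (x⁻¹ * y) * c y =
      ℓ (tmul (correlation (∑ x ∈ s, c x • leftTranslate f x)
        (∑ x ∈ s, c x • leftTranslate f x)) ξ) := by
    rw [correlation_sum_sum, ← tmulL_apply]
    simp only [map_sum, map_smul, sum_apply, smul_apply,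
      correlation_leftTranslate, smearedSlice_apply, tmulL_apply, smul_eq_mul]
    refine Finset.sum_congr rfl fun x _ => Finset.sum_congr rfl fun y _ => ?_
    ring
  rw [h]
  exact hℓ _ (correlation_self_mem_PD _) ξ hξ

end Witness

/-! ### The separability criterion -/

section Criterion

variable {G₁ : Type u} [Group G₁] [TopologicalSpace G₁] [IsTopologicalGroup G₁] [CompactSpace G₁]

/-- Pairing the diagonal of `(id ⊗ Λ) φ` with the constant `1`, where `Λ` is the smeared slice of
`ℓ`, evaluates `ℓ` at a two-sided mollification of `φ` in the first variable. -/
theorem exists_integral_diag_smearedSlice_eq {Y : Type v} [TopologicalSpace Y] [CompactSpace Y]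
    (u : C(G₁, ℝ)) (ℓ : C(G₁ × Y, ℂ) →L[ℂ] ℂ) (φ : C(G₁ × Y, ℂ)) :
    ∃ Φ : C(G₁ × Y, ℂ),
      ∫ x, smearedSlice ⟨fun g => (u g : ℂ), by fun_prop⟩ ℓ (φ.curry x) x ∂(haar G₁) = ℓ Φ ∧
      ∀ x y, Φ (x, y) =
        ∫ s, u s • (∫ t, u t • φ (s * x * t⁻¹, y) ∂(haar G₁)) ∂(haar G₁) := by
  let f : C(G₁, ℂ) := ⟨fun g => (u g : ℂ), by fun_prop⟩
  have hc : Continuous fun x => tmulL (correlation f (leftTranslate f x)) (φ.curry x) := by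
    have := continuous_correlation_leftTranslate f
    fun_prop
  refine ⟨∫ x, tmulL (correlation f (leftTranslate f x)) (φ.curry x) ∂(haar G₁),
    integral_haar_clm_comp ℓ hc, fun x y => ?_⟩
  rw [integral_haar_apply hc]
  have h1 (z : G₁) : tmulL (correlation f (leftTranslate f z)) (φ.curry z) (x, y) =
      ∫ s, u s * (u (z⁻¹ * (s * x)) * φ (z, y)) ∂(haar G₁) := by
    change (∫ s, conj (f s) * f (z⁻¹ * (s * x)) ∂(haar G₁)) * φ (z, y) = _
    rw [← integral_mul_const]
    congr 1 with s
    simp [f, mul_assoc]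
  simp only [h1]
  rw [integral_haar_swap (F := fun z s : G₁ => (u s : ℂ) * (u (z⁻¹ * (s * x)) * φ (z, y)))
    (by fun_prop)]
  congr 1 with s
  rw [integral_const_mul, Complex.real_smul, ← integral_haar_mul_left _ (s * x),
    ← integral_haar_inv (by fun_prop)]
  congr 2 with t
  simp [mul_assoc]

/-- If all smeared slices of `ℓ` map `φ` to positive definite functions, then `ℓ(φ) ≥ 0`, because
the mollifications of `φ` converge uniformly to `φ`. -/
theorem nonneg_of_forall_smearedSlice [T2Space G₁] {Y : Type v} [TopologicalSpace Y]
    [CompactSpace Y] (ℓ : C(G₁ × Y, ℂ) →L[ℂ] ℂ) (φ : C(G₁ × Y, ℂ))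
    (h : ∀ f : C(G₁, ℂ), idTensor (smearedSlice f ℓ) φ ∈ PD (G₁ × G₁)) : 0 ≤ ℓ φ := by
  have hcl : IsClosed {ψ | 0 ≤ ℓ ψ} := isClosed_le continuous_const ℓ.continuous
  refine hcl.closure_subset (Metric.mem_closure_iff.2 fun ε hε => ?_)
  -- the two-sided translates of `φ` are uniformly close to `φ` near the identity
  let T : C(G₁ × G₁, C(G₁ × Y, ℂ)) := ContinuousMap.curry
    ⟨fun q : (G₁ × G₁) × (G₁ × Y) => φ (q.1.1 * q.2.1 * q.1.2⁻¹, q.2.2), by fun_prop⟩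
  have hT1 : T (1, 1) = φ := by
    ext q
    simp [T]
  obtain ⟨V, hV, hVε⟩ : ∃ V ∈ nhds (1 : G₁), ∀ a ∈ V, ∀ b ∈ V, ‖T (a, b) - φ‖ ≤ ε / 2 := by
    have h := T.continuous.tendsto (1, 1) (Metric.closedBall_mem_nhds _ (half_pos hε))
    rw [nhds_prod_eq] at h
    obtain ⟨V, hV, hVV⟩ := Filter.mem_prod_self_iff.1 h
    exact ⟨V, hV, fun a ha b hb => by simpa [dist_eq_norm, hT1] using hVV (Set.mk_mem_prod ha hb)⟩
  obtain ⟨u, hu, hu1, huV⟩ := exists_density_of_mem_nhds_one hV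
  obtain ⟨Φ, hΦ, hΦval⟩ := exists_integral_diag_smearedSlice_eq u ℓ φ
  refine ⟨Φ, ?_, ?_⟩
  · change 0 ≤ ℓ Φ
    rw [← hΦ]
    exact integral_nonneg_of_mem_PD (comp_diag_mem_PD (h _))
  · rw [dist_comm, dist_eq_norm]
    refine lt_of_le_of_lt ((ContinuousMap.norm_le _ (half_pos hε).le).2 fun q => ?_)
      (half_lt_self hε)
    rw [ContinuousMap.sub_apply, ← Prod.mk.eta (p := q), hΦval]
    exact norm_integral_density_smul_smul_sub_le hu hu1 huV
      (f := fun s t => φ (s * q.1 * t⁻¹, q.2)) (by fun_prop) fun a ha b hb =>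
        ((T (a, b) - φ).norm_coe_le_norm q).trans (hVε a ha b hb)

variable [T2Space G₁] {G₂ : Type v} [Group G₂] [TopologicalSpace G₂] [IsTopologicalGroup G₂]
  [CompactSpace G₂]

theorem idTensor_mem_PD_of_mem_sep {φ : C(G₁ × G₂, ℂ)} (hφ : φ ∈ Sep G₁ G₂)
    {Λ : C(G₂, ℂ) →L[ℂ] C(G₁, ℂ)} (hΛ : PreservesPD Λ) : idTensor Λ φ ∈ PD (G₁ × G₁) := by
  refine isClosed_PD.closure_subset (map_mem_closure (idTensor Λ).continuous hφ.2 ?_)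
  rintro ψ ⟨-, K, p, ε, η, hp, -, hε, hη, hψ⟩
  have h : ψ = ∑ m, (p m : ℂ) • tmul (ε m) (η m) := by
    ext ⟨g₁, g₂⟩
    simp [hψ, tmul]
  rw [h, map_sum]
  simp only [map_smul, idTensor_tmul]
  exact sum_smul_mem_PD _ hp fun m => tmul_mem_PD (hε m).1.1 (hΛ _ (hη m).1.1)

end Criterion

end CompactGroup

end

theorem mainTheorem1
    {G₁ : Type*} [Group G₁] [TopologicalSpace G₁] [IsTopologicalGroup G₁]
    [CompactSpace G₁] [T2Space G₁]
    {G₂ : Type*} [Group G₂] [TopologicalSpace G₂] [IsTopologicalGroup G₂]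
    [CompactSpace G₂] [T2Space G₂]
    (φ : C(G₁ × G₂, ℂ)) (hφ : φ ∈ CompactGroup.PDOne (G₁ × G₂)) :
    φ ∈ CompactGroup.Sep G₁ G₂ ↔
      ∀ Λ : C(G₂, ℂ) →L[ℂ] C(G₁, ℂ), CompactGroup.PreservesPD Λ →
        CompactGroup.idTensor Λ φ ∈ CompactGroup.PD (G₁ × G₁) := by
  refine ⟨fun h Λ hΛ => CompactGroup.idTensor_mem_PD_of_mem_sep h hΛ, fun h => ?_⟩
  by_contra hsep
  obtain ⟨ℓ, hℓ, hℓφ⟩ := CompactGroup.exists_functional_of_notMem_sep hφ hsep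
  exact hℓφ (CompactGroup.nonneg_of_forall_smearedSlice ℓ φ fun f =>
    h _ (CompactGroup.preservesPD_smearedSlice f hℓ))
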